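/- Let $K\ge 1$, let $\varepsilon=2\varepsilon'^2$ with $0<\varepsilon<\infty$, let $w_1,\dots,w_K>0$ with $\sum_k w_k=1$, and let $\alpha_k=\mathcal N(\mu_k,\sigma_k^2)$ be Gaussian measures on $\mathbb R$ with $\mu_k\in\mathbb R$ and $\sigma_k>0$. For probability measures $\alpha,\beta$ on $\mathbb R$ let $\Pi(\alpha,\beta)$ be the set of measures on $\mathbb R^2$ with marginals $\alpha$ and $\beta$, and put $$\mathrm{OT}_\varepsilon(\alpha,\beta)=\inf_{\pi\in\Pi(\alpha,\beta)}\int (x-y)^2\,d\pi(x,y)+\varepsilon\,\mathrm{KL}(\pi\,|\,\alpha\otimes\beta),$$ $$S_\varepsilon(\alpha,\beta)=\mathrm{OT}_\varepsilon(\alpha,\beta)-\tfrac12\bigl(\mathrm{OT}_\varepsilon(\alpha,\alpha)+\mathrm{OT}_\varepsilon(\beta,\beta)\bigr).$$ Let $\mathcal G(\mathbb R)$ be the set of sub-Gaussian probability measures on $\mathbb R$, i.e. those $\alpha$ with $\int e^{x^2/(2q^2)}\,d\alpha(x)\le 2$ for some $q>0$. Let $\bar\mu=\sum_k w_k\mu_k$.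 Then: 1. The equation $$\sum_{k=1}^K w_k\sqrt{\varepsilon'^4+4\sigma_k^2S^2}=\sqrt{\varepsilon'^4+4S^4}$$ has exactly one solution $S>0$. 2. With this $S$, the debiased Sinkhorn barycenter exists, is unique and is Gaussian: $$\operatorname*{argmin}_{\alpha\in\mathcal G(\mathbb R)}\ \sum_{k=1}^K w_k\,S_\varepsilon(\alpha_k,\alpha)=\{\mathcal N(\bar\mu,S^2)\}.$$ 3. $\min_k\sigma_k\le S\le\max_k\sigma_k$, and both inequalities are strict if the $\sigma_k$ are not all equal. 4. In particular, if all $\sigma_k$ are equal to some $\sigma>0$, then the debiased barycenter is $\mathcal N(\bar\mu,\sigma^2)$. -/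

import Mathlib

open MeasureTheory ProbabilityTheory
open scoped ENNReal BigOperators

noncomputable section

namespace SinkhornBarycenter

/-- The couplings `Π(α, β)`: measures on `ℝ × ℝ` with first marginal `α` and second marginal `β`. -/
def couplings (α β : Measure ℝ) : Set (Measure (ℝ × ℝ)) :=
  {π | π.map Prod.fst = α ∧ π.map Prod.snd = β}

/-- Entropy-regularized optimal transport on `ℝ` for the quadratic cost `C(x, y) = (x - y)²`, with
the product of the marginals as reference measure:
`OT_ε(α, β) = inf_{π ∈ Π(α, β)} ∫ C dπ + ε KL(π | α ⊗ β)`, with values in `[0, ∞]`. -/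
def entropicOT (ε : ℝ) (α β : Measure ℝ) : ℝ≥0∞ :=
  ⨅ π ∈ couplings α β,
    (∫⁻ p, ENNReal.ofReal ((p.1 - p.2) ^ 2) ∂π)
      + ENNReal.ofReal ε * InformationTheory.klDiv π (α.prod β)

/-- The Sinkhorn divergence `S_ε(α, β) = OT_ε(α, β) - (OT_ε(α, α) + OT_ε(β, β)) / 2`.
It is only used for probability measures with a finite second moment, for which all three terms
are finite (compare with the product coupling). -/
def sinkhornDiv (ε : ℝ) (α β : Measure ℝ) : ℝ :=
  (entropicOT ε α β).toReal
    - ((entropicOT ε α α).toReal + (entropicOT ε β β).toReal) / 2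

/-- Sub-Gaussian probability measures on `ℝ`: `∫ exp(x² / (2 q²)) dα(x) ≤ 2` for some `q > 0`. -/
def subGaussian : Set (Measure ℝ) :=
  {α | IsProbabilityMeasure α ∧
    ∃ q : ℝ, 0 < q ∧ ∫⁻ x, ENNReal.ofReal (Real.exp (x ^ 2 / (2 * q ^ 2))) ∂α ≤ 2}

/-- The set of minimizers, among sub-Gaussian probability measures `α`, of
`∑ k, w k * S_ε(a k, α)`: the debiased Sinkhorn barycenters of the measures `a k`
with weights `w k`. -/
def debiasedBarycenters {K : ℕ} (ε : ℝ) (w : Fin K → ℝ) (a : Fin K → Measure ℝ) :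
    Set (Measure ℝ) :=
  {α | α ∈ subGaussian ∧
    IsMinOn (fun β => ∑ k, w k * sinkhornDiv ε (a k) β) subGaussian α}

/-- The Gaussian measure `N(m, s²)` on `ℝ`, parametrized by its standard deviation. -/
def gaussianStd (m s : ℝ) : Measure ℝ := gaussianReal m (Real.toNNReal (s ^ 2))

end SinkhornBarycenter

end

/-! Write e = ε/2 = ε'² and γ = N(μ̄, S²). The cost plus ε times the log-density of the optimal
Gaussian coupling of α_k and γ splits as F_k(x) + G_k(y) with F_k, G_k quadratic. By the Gibbs
inequality ∫ F_k dα_k + ∫ G_k dβ bounds OT_ε(α_k, β) from below for every β with a second moment,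
with equality at β = γ (`le_entropicOT_gaussianReal`, `entropicOT_gaussianReal_le`). G_k is affine
in μ_k and in the covariance of the coupling, and the fixed point equation says that these
covariances average to that of the self-coupling of γ. Hence ∑ w_k G_k = G, the self-potential of γ
(`sum_sndPotential`).

The term OT_ε(β, β) enters with a minus sign, so it needs an upper bound, that is, a good
self-coupling of an arbitrary β. Add Gaussian noise of variance t to x ~ β and draw y from the
posterior given the output z. The self-kernel of γ is an integral over z of products of two channel
densities, so data processing bounds OT_ε(β, β) by 2 ∫ G dβ + const - ε KL(β ∗ N(0, t) | γ ∗ N(0,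
t)) (`exists_posterior_coupling`, `entropicOT_self_le`). Thus the objective at β exceeds that at γ
by at least e times this relative entropy. It vanishes only if the smoothings agree, and then β = γ
by characteristic functions.

For the scalar equation, put u = S²: the left side is concave in u, the right side strictly convex,
and both equal e at u = 0, so they meet at most once for u > 0. The intermediate value theorem on
[min σ, max σ] gives existence and the bounds. -/

namespace SinkhornBarycenter

open InformationTheory

/-! ### Exponential densities and relative entropy. -/

section ExpDensity

variable {X Y : Type*} [MeasurableSpace X] [MeasurableSpace Y]

/-- The measure with density `exp φ` with respect to `ν`. -/
noncomputable def expDensity (ν : Measure X) (φ : X → ℝ) : Measure X :=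
  ν.withDensity fun x => ENNReal.ofReal (Real.exp (φ x))

lemma expDensity_absolutelyContinuous (ν : Measure X) (φ : X → ℝ) : expDensity ν φ ≪ ν :=
  withDensity_absolutelyContinuous _ _

lemma lintegral_expDensity {ν : Measure X} {φ : X → ℝ} (hφ : Measurable φ) {f : X → ℝ≥0∞}
    (hf : Measurable f) :
    ∫⁻ x, f x ∂(expDensity ν φ) = ∫⁻ x, ENNReal.ofReal (Real.exp (φ x)) * f x ∂ν := by
  rw [expDensity, lintegral_withDensity_eq_lintegral_mul _ (by fun_prop) hf]
  rfl

lemma expDensity_expDensity {ν : Measure X} {φ ψ : X → ℝ} (hφ : Measurable φ)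
    (hψ : Measurable ψ) :
    expDensity (expDensity ν φ) ψ = expDensity ν (fun x => φ x + ψ x) := by
  rw [expDensity, expDensity, expDensity, ← withDensity_mul _ (by fun_prop) (by fun_prop)]
  congr 1
  ext x
  simp only [Pi.mul_apply]
  rw [Real.exp_add, ENNReal.ofReal_mul (Real.exp_pos _).le]

lemma isProbabilityMeasure_expDensity {ν : Measure X} {φ : X → ℝ}
    (h : ∫⁻ x, ENNReal.ofReal (Real.exp (φ x)) ∂ν = 1) :
    IsProbabilityMeasure (expDensity ν φ) :=
  ⟨by rw [expDensity, withDensity_apply _ MeasurableSet.univ, Measure.restrict_univ, h]⟩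

lemma integrable_exp_of_isProbabilityMeasure {ν : Measure X} {φ : X → ℝ} (hφ : Measurable φ)
    [hp : IsProbabilityMeasure (expDensity ν φ)] : Integrable (fun x => Real.exp (φ x)) ν := by
  refine ⟨by fun_prop, ?_⟩
  rw [hasFiniteIntegral_iff_ofReal (Filter.Eventually.of_forall fun x => (Real.exp_pos _).le)]
  have := hp.measure_univ
  rw [expDensity, withDensity_apply _ MeasurableSet.univ, Measure.restrict_univ] at this
  rw [this]
  exact ENNReal.one_lt_top

lemma llr_expDensity {ν : Measure X} [SigmaFinite ν] {φ : X → ℝ} (hφ : Measurable φ) :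
    llr (expDensity ν φ) ν =ᵐ[expDensity ν φ] φ := by
  have h := Measure.rnDeriv_withDensity ν
    (f := fun x => ENNReal.ofReal (Real.exp (φ x))) (by fun_prop)
  filter_upwards [(expDensity_absolutelyContinuous ν φ).ae_le h] with x hx
  rw [llr, expDensity, hx, ENNReal.toReal_ofReal (Real.exp_pos _).le, Real.log_exp]

lemma klDiv_expDensity_ne_top {ν : Measure X} [SigmaFinite ν] {φ : X → ℝ}
    (hφ : Measurable φ) (hi : Integrable φ (expDensity ν φ)) : klDiv (expDensity ν φ) ν ≠ ⊤ :=
  klDiv_ne_top (expDensity_absolutelyContinuous ν φ) (hi.congr (llr_expDensity hφ).symm)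

lemma toReal_klDiv_expDensity {ν : Measure X} [IsProbabilityMeasure ν] {φ : X → ℝ}
    (hφ : Measurable φ) [IsProbabilityMeasure (expDensity ν φ)] :
    (klDiv (expDensity ν φ) ν).toReal = ∫ x, φ x ∂(expDensity ν φ) := by
  rw [toReal_klDiv_of_measure_eq (expDensity_absolutelyContinuous ν φ) (by simp),
    integral_congr_ae (llr_expDensity hφ)]

/-- The Gibbs variational inequality. -/
lemma integral_le_toReal_klDiv {π ν : Measure X} [IsProbabilityMeasure π] [IsProbabilityMeasure ν]
    {φ : X → ℝ} (hφ : Measurable φ) [IsProbabilityMeasure (expDensity ν φ)]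
    (hi : Integrable φ π) (hfin : klDiv π ν ≠ ⊤) :
    ∫ x, φ x ∂π ≤ (klDiv π ν).toReal := by
  obtain ⟨hac, hllr⟩ := klDiv_ne_top_iff.1 hfin
  have hexp := integrable_exp_of_isProbabilityMeasure (ν := ν) hφ
  rw [toReal_klDiv_of_measure_eq hac (by simp)]
  have hne : ∫ x, Real.exp (φ x) ∂ν = 1 := by
    have := (inferInstance : IsProbabilityMeasure (expDensity ν φ)).measure_univ
    rw [expDensity, withDensity_apply _ MeasurableSet.univ, Measure.restrict_univ] at this
    rw [integral_eq_lintegral_of_nonneg_ae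
      (Filter.Eventually.of_forall fun x => (Real.exp_pos _).le) (by fun_prop), this]
    simp
  -- The nonnegative entropy of `π` relative to `ν.tilted φ` is KL(π | ν) - ∫ φ dπ + log ∫ exp φ dν,
  -- and the last term is 0 by `hne`.
  have h2 := integral_llr_tilted_right hac hi hexp hllr
  have hprob : IsProbabilityMeasure (ν.tilted φ) := isProbabilityMeasure_tilted hexp
  have h3 := integral_llr_add_sub_measure_univ_nonneg
    (hac.trans (absolutelyContinuous_tilted hexp)) (integrable_llr_tilted_right hac hi hllr hexp)
  rw [h2, hne] at h3
  simp at h3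
  linarith

end ExpDensity

/-! ### Channels, posteriors and the posterior self-coupling. -/

section Channel

variable {X Y Z : Type*} [MeasurableSpace X] [MeasurableSpace Y] [MeasurableSpace Z]

lemma map_fst_expDensity_prod {μ : Measure X} {ν : Measure Y} [SFinite μ] [SFinite ν]
    {φ : X × Y → ℝ} (hφ : Measurable φ)
    (h : ∀ x, ∫⁻ y, ENNReal.ofReal (Real.exp (φ (x, y))) ∂ν = 1) :
    (expDensity (μ.prod ν) φ).map Prod.fst = μ := by
  refine Measure.ext_of_lintegral _ fun f hf => ?_
  rw [lintegral_map hf measurable_fst, lintegral_expDensity hφ (by fun_prop),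
    lintegral_prod _ (by fun_prop)]
  refine lintegral_congr fun x => ?_
  dsimp only
  rw [lintegral_mul_const _ (by fun_prop), h, one_mul]

lemma map_snd_expDensity_prod {μ : Measure X} {ν : Measure Y} [SFinite μ] [SFinite ν]
    {φ : X × Y → ℝ} (hφ : Measurable φ) :
    (expDensity (μ.prod ν) φ).map Prod.snd
      = ν.withDensity fun y => ∫⁻ x, ENNReal.ofReal (Real.exp (φ (x, y))) ∂μ := by
  have hm : Measurable fun y => ∫⁻ x, ENNReal.ofReal (Real.exp (φ (x, y))) ∂μ :=
    Measurable.lintegral_prod_left' (f := fun p => ENNReal.ofReal (Real.exp (φ p))) (by fun_prop)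
  refine Measure.ext_of_lintegral _ fun f hf => ?_
  rw [lintegral_map hf measurable_snd, lintegral_expDensity hφ (by fun_prop),
    lintegral_prod_symm' _ (by fun_prop), lintegral_withDensity_eq_lintegral_mul _ hm hf]
  refine lintegral_congr fun y => ?_
  dsimp only
  rw [lintegral_mul_const _ (by fun_prop), Pi.mul_apply]

lemma isProbabilityMeasure_expDensity_prod {μ : Measure X} {ν : Measure Y}
    [IsProbabilityMeasure μ] [SFinite ν] {φ : X × Y → ℝ} (hφ : Measurable φ)
    (h : ∀ x, ∫⁻ y, ENNReal.ofReal (Real.exp (φ (x, y))) ∂ν = 1) :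
    IsProbabilityMeasure (expDensity (μ.prod ν) φ) := by
  refine isProbabilityMeasure_expDensity ?_
  rw [lintegral_prod _ (by fun_prop)]
  simp [h]

/-- The log-density of the second marginal of `expDensity (β.prod ρ) θ` with respect to `ρ`. -/
noncomputable def logMarginal (β : Measure X) (θ : X × Z → ℝ) (z : Z) : ℝ :=
  Real.log (∫⁻ x, ENNReal.ofReal (Real.exp (θ (x, z))) ∂β).toReal

lemma measurable_logMarginal {β : Measure X} [SFinite β] {θ : X × Z → ℝ} (hθ : Measurable θ) :
    Measurable (logMarginal β θ) := by
  have hm : Measurable fun y => ∫⁻ x, ENNReal.ofReal (Real.exp (θ (x, y))) ∂β :=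
    Measurable.lintegral_prod_left' (f := fun p => ENNReal.ofReal (Real.exp (θ p))) (by fun_prop)
  unfold logMarginal
  fun_prop

variable {β : Measure X} {ρ : Measure Z} [IsProbabilityMeasure β] [IsProbabilityMeasure ρ]
  {θ : X × Z → ℝ}

/-- The total mass is 1 and the integrand is positive, so the marginal density is almost everywhere
neither `⊤` nor 0, and the default values of `toReal` and `Real.log` do not matter. -/
lemma ofReal_exp_logMarginal (hθ : Measurable θ)
    (h1 : ∀ x, ∫⁻ z, ENNReal.ofReal (Real.exp (θ (x, z))) ∂ρ = 1) :
    ∀ᵐ z ∂ρ, ENNReal.ofReal (Real.exp (logMarginal β θ z))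
      = ∫⁻ x, ENNReal.ofReal (Real.exp (θ (x, z))) ∂β := by
  have hm : Measurable fun z => ∫⁻ x, ENNReal.ofReal (Real.exp (θ (x, z))) ∂β :=
    Measurable.lintegral_prod_left' (f := fun p => ENNReal.ofReal (Real.exp (θ p))) (by fun_prop)
  have hfin : ∫⁻ z, ∫⁻ x, ENNReal.ofReal (Real.exp (θ (x, z))) ∂β ∂ρ ≠ ⊤ := by
    rw [lintegral_lintegral_swap (by fun_prop)]
    simp [h1]
  filter_upwards [ae_lt_top hm hfin] with z hz
  have hpos : ∫⁻ x, ENNReal.ofReal (Real.exp (θ (x, z))) ∂β ≠ 0 := by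
    rw [Ne, lintegral_eq_zero_iff (by fun_prop)]
    intro h0
    obtain ⟨x, hx⟩ := h0.exists
    simp only [Pi.zero_apply, ENNReal.ofReal_eq_zero] at hx
    exact absurd hx (not_le.2 (Real.exp_pos _))
  rw [logMarginal, Real.exp_log (ENNReal.toReal_pos hpos hz.ne), ENNReal.ofReal_toReal hz.ne]

lemma map_snd_expDensity_eq_expDensity (hθ : Measurable θ)
    (h1 : ∀ x, ∫⁻ z, ENNReal.ofReal (Real.exp (θ (x, z))) ∂ρ = 1) :
    (expDensity (β.prod ρ) θ).map Prod.snd = expDensity ρ (logMarginal β θ) := by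
  rw [map_snd_expDensity_prod hθ, expDensity]
  refine withDensity_congr_ae ?_
  filter_upwards [ofReal_exp_logMarginal (β := β) hθ h1] with z hz
  exact hz.symm

/-- The joint law of `(x, y, z)`, where `x` has law `β`, `z` is the output of the channel with
log-density `θ` with respect to `ρ` applied to `x`, and `y` is drawn from the posterior law of the
input given the output `z`. -/
noncomputable def posteriorJoint (β : Measure X) (ρ : Measure Z) (θ : X × Z → ℝ) :
    Measure ((X × X) × Z) :=
  expDensity ((β.prod β).prod ρ)
    fun p => θ (p.1.1, p.2) + θ (p.1.2, p.2) - logMarginal β θ p.2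

/-- Integrating out the resampled input produces exactly the marginal density of z, which cancels
the normalization. -/
lemma map_left_posteriorJoint (hθ : Measurable θ)
    (h1 : ∀ x, ∫⁻ z, ENNReal.ofReal (Real.exp (θ (x, z))) ∂ρ = 1) :
    (posteriorJoint β ρ θ).map (fun p => (p.1.1, p.2)) = expDensity (β.prod ρ) θ := by
  have hL : Measurable (logMarginal β θ) := measurable_logMarginal hθ
  refine Measure.ext_of_lintegral _ fun f hf => ?_
  rw [lintegral_map hf (by fun_prop), posteriorJoint,
    lintegral_expDensity (by fun_prop) (by fun_prop), lintegral_expDensity hθ hf,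
    lintegral_prod _ (by fun_prop), lintegral_prod _ (by fun_prop), lintegral_prod _ (by fun_prop)]
  refine lintegral_congr fun x => ?_
  rw [lintegral_lintegral_swap (by fun_prop)]
  have h := ofReal_exp_logMarginal (β := β) hθ h1
  refine lintegral_congr_ae ?_
  filter_upwards [h] with z hz
  have : ∀ y, ENNReal.ofReal (Real.exp (θ (x, z) + θ (y, z) - logMarginal β θ z))
      = ENNReal.ofReal (Real.exp (θ (x, z) - logMarginal β θ z))
        * ENNReal.ofReal (Real.exp (θ (y, z))) := fun y => by
    rw [← ENNReal.ofReal_mul (Real.exp_pos _).le, ← Real.exp_add]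
    ring_nf
  simp_rw [this]
  rw [lintegral_mul_const _ (by fun_prop), lintegral_const_mul _ (by fun_prop), ← hz,
    ← ENNReal.ofReal_mul (Real.exp_pos _).le, ← Real.exp_add]
  ring_nf

/-- The joint law is symmetric in its two inputs. -/
lemma map_right_posteriorJoint (hθ : Measurable θ)
    (h1 : ∀ x, ∫⁻ z, ENNReal.ofReal (Real.exp (θ (x, z))) ∂ρ = 1) :
    (posteriorJoint β ρ θ).map (fun p => (p.1.2, p.2)) = expDensity (β.prod ρ) θ := by
  have hL : Measurable (logMarginal β θ) := measurable_logMarginal hθ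
  rw [← map_left_posteriorJoint hθ h1]
  refine Measure.ext_of_lintegral _ fun f hf => ?_
  rw [lintegral_map hf (by fun_prop), lintegral_map hf (by fun_prop), posteriorJoint,
    lintegral_expDensity (by fun_prop) (by fun_prop),
    lintegral_expDensity (by fun_prop) (by fun_prop),
    lintegral_prod _ (by fun_prop), lintegral_prod _ (by fun_prop),
    lintegral_prod _ (by fun_prop), lintegral_prod _ (by fun_prop)]
  dsimp only
  have hg : Measurable fun q : X × X => ∫⁻ z, ENNReal.ofReal
      (Real.exp (θ (q.1, z) + θ (q.2, z) - logMarginal β θ z)) * f (q.2, z) ∂ρ :=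
    Measurable.lintegral_prod_right' (f := fun p : (X × X) × Z => ENNReal.ofReal
      (Real.exp (θ (p.1.1, p.2) + θ (p.1.2, p.2) - logMarginal β θ p.2)) * f (p.1.2, p.2))
      (by fun_prop)
  rw [lintegral_lintegral_swap hg.aemeasurable]
  refine lintegral_congr fun x => lintegral_congr fun y => lintegral_congr fun z => ?_
  simp only [add_comm]

/-- The self-coupling of `β` obtained by passing through a channel and back through its posterior
has an entropy controlled by that of the output law. -/
lemma exists_posterior_coupling (hθ : Measurable θ)
    (h1 : ∀ x, ∫⁻ z, ENNReal.ofReal (Real.exp (θ (x, z))) ∂ρ = 1)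
    (hθi : Integrable θ (expDensity (β.prod ρ) θ))
    {l : X × X → ℝ} (hl : Measurable l)
    (h2 : ∀ x y, ∫⁻ z, ENNReal.ofReal (Real.exp (θ (x, z) + θ (y, z) - l (x, y))) ∂ρ = 1)
    (hli : ∀ π : Measure (X × X), π.map Prod.fst = β → π.map Prod.snd = β → Integrable l π) :
    klDiv ((expDensity (β.prod ρ) θ).map Prod.snd) ρ ≠ ⊤ ∧
    ∃ π : Measure (X × X), π.map Prod.fst = β ∧ π.map Prod.snd = β ∧
      klDiv π (β.prod β) ≠ ⊤ ∧
      (klDiv π (β.prod β)).toReal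
        ≤ ∫ p, l p ∂π - (klDiv ((expDensity (β.prod ρ) θ).map Prod.snd) ρ).toReal := by
  have hL : Measurable (logMarginal β θ) := measurable_logMarginal hθ
  have hJ : IsProbabilityMeasure (expDensity (β.prod ρ) θ) :=
    isProbabilityMeasure_expDensity_prod hθ h1
  have hρ : ρ = (β.prod ρ).map Prod.snd := by simp [Measure.map_snd_prod]
  -- With `ρ` seen as a marginal of `β.prod ρ`, data processing bounds the output entropy by the
  -- joint one.
  have hkl : klDiv ((expDensity (β.prod ρ) θ).map Prod.snd) ρ ≠ ⊤ := by
    conv => enter [1, 2]; rw [hρ]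
    exact ne_top_of_le_ne_top (klDiv_expDensity_ne_top hθ hθi)
      (klDiv_map_le _ _ measurable_snd)
  refine ⟨hkl, ?_⟩
  have hQ := map_snd_expDensity_eq_expDensity (β := β) hθ h1
  have hQp : IsProbabilityMeasure (expDensity ρ (logMarginal β θ)) := by
    rw [← hQ]; exact Measure.isProbabilityMeasure_map (by fun_prop)
  have hl1 := map_left_posteriorJoint (β := β) hθ h1
  have hr1 := map_right_posteriorJoint (β := β) hθ h1
  have hM : IsProbabilityMeasure (posteriorJoint β ρ θ) := by
    refine ⟨?_⟩
    have := hJ.measure_univ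
    rwa [← hl1, Measure.map_apply (by fun_prop) MeasurableSet.univ, Set.preimage_univ] at this
  have hJfst := map_fst_expDensity_prod (μ := β) hθ h1
  set π := (posteriorJoint β ρ θ).map Prod.fst with hπ
  have hπ1 : π.map Prod.fst = β := by
    rw [hπ, Measure.map_map (by fun_prop) (by fun_prop)]
    conv_rhs => rw [← hJfst, ← hl1, Measure.map_map (by fun_prop) (by fun_prop)]
    rfl
  have hπ2 : π.map Prod.snd = β := by
    rw [hπ, Measure.map_map (by fun_prop) (by fun_prop)]
    conv_rhs => rw [← hJfst, ← hr1, Measure.map_map (by fun_prop) (by fun_prop)]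
    rfl
  have hMsnd : (posteriorJoint β ρ θ).map Prod.snd = expDensity ρ (logMarginal β θ) := by
    rw [← hQ, ← hl1, Measure.map_map (by fun_prop) (by fun_prop)]
    rfl
  have hLi : Integrable (logMarginal β θ) (expDensity ρ (logMarginal β θ)) := by
    rw [hQ] at hkl
    exact (klDiv_ne_top_iff.1 hkl).2.congr (llr_expDensity hL)
  have hLM : Integrable (fun p : (X × X) × Z => logMarginal β θ p.2) (posteriorJoint β ρ θ) := by
    rw [← hMsnd] at hLi
    exact hLi.comp_measurable measurable_snd
  have hlπ := hli π hπ1 hπ2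
  have hlM : Integrable (fun p : (X × X) × Z => l p.1) (posteriorJoint β ρ θ) :=
    hlπ.comp_measurable measurable_fst
  -- `R` draws independent inputs and then z from the kernel normalized by `l`. Relative to it the
  -- posterior joint law has log-density `l` minus the log-marginal of z, so forgetting z gives the
  -- claim by data processing.
  set R := expDensity ((β.prod β).prod ρ)
    (fun p => θ (p.1.1, p.2) + θ (p.1.2, p.2) - l p.1) with hR
  have hRp : IsProbabilityMeasure R :=
    isProbabilityMeasure_expDensity_prod (by fun_prop) fun p => h2 p.1 p.2
  have hRfst : R.map Prod.fst = β.prod β :=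
    map_fst_expDensity_prod (by fun_prop) fun p => h2 p.1 p.2
  have hMR : posteriorJoint β ρ θ = expDensity R (fun p => l p.1 - logMarginal β θ p.2) := by
    rw [hR, expDensity_expDensity (by fun_prop) (by fun_prop), posteriorJoint]
    congr 1
    ext p
    ring
  have hi : Integrable (fun p : (X × X) × Z => l p.1 - logMarginal β θ p.2)
      (posteriorJoint β ρ θ) := hlM.sub hLM
  have hfin : klDiv (posteriorJoint β ρ θ) R ≠ ⊤ := by
    rw [hMR] at hi ⊢
    exact klDiv_expDensity_ne_top (by fun_prop) hi
  have hle : klDiv π (β.prod β) ≤ klDiv (posteriorJoint β ρ θ) R := by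
    rw [← hRfst]
    exact klDiv_map_le _ _ measurable_fst
  refine ⟨π, hπ1, hπ2, ne_top_of_le_ne_top hfin hle, ?_⟩
  refine (ENNReal.toReal_mono hfin hle).trans (le_of_eq ?_)
  have e1 : (klDiv (posteriorJoint β ρ θ) R).toReal
      = ∫ p, (l p.1 - logMarginal β θ p.2) ∂(posteriorJoint β ρ θ) := by
    rw [hMR] at hM ⊢
    exact toReal_klDiv_expDensity (by fun_prop)
  rw [e1, integral_sub hlM hLM, hQ, toReal_klDiv_expDensity hL, hπ,
    integral_map (by fun_prop) hl.aestronglyMeasurable, ← hMsnd,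
    integral_map (by fun_prop) hL.aestronglyMeasurable]

end Channel

/-! ### Real-valued bounds for the entropic cost; integrability of quadratics. -/

section EntropicOT

variable {ε : ℝ} {α β : Measure ℝ} {π : Measure (ℝ × ℝ)}

lemma entropicOT_le_of_coupling (hε : 0 ≤ ε) (hπ : π ∈ couplings α β)
    (hi : Integrable (fun p => (p.1 - p.2) ^ 2) π) (hk : klDiv π (α.prod β) ≠ ⊤) :
    entropicOT ε α β ≠ ⊤ ∧ (entropicOT ε α β).toReal
      ≤ ∫ p, (p.1 - p.2) ^ 2 ∂π + ε * (klDiv π (α.prod β)).toReal := by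
  have hle : entropicOT ε α β ≤ ENNReal.ofReal
      (∫ p, (p.1 - p.2) ^ 2 ∂π + ε * (klDiv π (α.prod β)).toReal) := by
    refine (iInf₂_le π hπ).trans (le_of_eq ?_)
    rw [ENNReal.ofReal_add (integral_nonneg fun p => sq_nonneg _) (by positivity),
      ENNReal.ofReal_mul hε, ENNReal.ofReal_toReal hk,
      ofReal_integral_eq_lintegral_ofReal hi (Filter.Eventually.of_forall fun p => sq_nonneg _)]
  refine ⟨ne_top_of_le_ne_top ENNReal.ofReal_ne_top hle, ?_⟩
  refine (ENNReal.toReal_mono ENNReal.ofReal_ne_top hle).trans (le_of_eq ?_)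
  exact ENNReal.toReal_ofReal
    (add_nonneg (integral_nonneg fun p => sq_nonneg _) (by positivity))

/-- Couplings with infinite entropy (here `ε > 0` matters) or non-integrable cost have value `⊤`, so
only the others need testing. -/
lemma le_toReal_entropicOT (hε : 0 < ε) (hfin : entropicOT ε α β ≠ ⊤) {t : ℝ}
    (h : ∀ π ∈ couplings α β, Integrable (fun p => (p.1 - p.2) ^ 2) π →
      klDiv π (α.prod β) ≠ ⊤ →
      t ≤ ∫ p, (p.1 - p.2) ^ 2 ∂π + ε * (klDiv π (α.prod β)).toReal) :
    t ≤ (entropicOT ε α β).toReal := by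
  rw [← ENNReal.ofReal_le_iff_le_toReal hfin]
  refine le_iInf₂ fun π hπ => ?_
  by_cases hk : klDiv π (α.prod β) = ⊤
  · rw [hk, ENNReal.mul_top (by simpa using hε), add_top]
    exact le_top
  by_cases hi : Integrable (fun p : ℝ × ℝ => (p.1 - p.2) ^ 2) π
  · rw [← ofReal_integral_eq_lintegral_ofReal hi
      (Filter.Eventually.of_forall fun p => sq_nonneg _), ← ENNReal.ofReal_toReal hk,
      ← ENNReal.ofReal_mul hε.le, ← ENNReal.ofReal_add (integral_nonneg fun p => sq_nonneg _)
      (by positivity)]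
    exact ENNReal.ofReal_le_ofReal (h π hπ hi hk)
  · have : ∫⁻ p : ℝ × ℝ, ENNReal.ofReal ((p.1 - p.2) ^ 2) ∂π = ⊤ := by
      by_contra hne
      refine hi ⟨by fun_prop, ?_⟩
      rw [hasFiniteIntegral_iff_ofReal (Filter.Eventually.of_forall fun p => sq_nonneg _)]
      exact lt_top_iff_ne_top.2 hne
    rw [this, top_add]
    exact le_top

lemma isProbabilityMeasure_of_mem_couplings [IsProbabilityMeasure α] (hπ : π ∈ couplings α β) :
    IsProbabilityMeasure π := by
  refine ⟨?_⟩
  have := measure_univ (μ := α)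
  rwa [← hπ.1, Measure.map_apply measurable_fst MeasurableSet.univ, Set.preimage_univ] at this

lemma integrable_quadratic [IsFiniteMeasure π] (h1 : MemLp (fun p : ℝ × ℝ => p.1) 2 π)
    (h2 : MemLp (fun p : ℝ × ℝ => p.2) 2 π) (A B C D E F : ℝ) :
    Integrable (fun p : ℝ × ℝ =>
      A * p.1 ^ 2 + B * p.2 ^ 2 + C * (p.1 * p.2) + D * p.1 + E * p.2 + F) π := by
  have i1 := h1.integrable (by norm_num)
  have i2 := h2.integrable (by norm_num)
  have i3 := h1.integrable_sq
  have i4 := h2.integrable_sq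
  have i5 : Integrable (fun p : ℝ × ℝ => p.1 * p.2) π := h1.integrable_mul h2
  fun_prop

lemma memLp_fst_of_mem_couplings (hα : MemLp id 2 α) (hπ : π ∈ couplings α β) :
    MemLp (fun p : ℝ × ℝ => p.1) 2 π := by
  rw [← hπ.1] at hα
  exact hα.comp_of_map (by fun_prop)

lemma memLp_snd_of_mem_couplings (hβ : MemLp id 2 β) (hπ : π ∈ couplings α β) :
    MemLp (fun p : ℝ × ℝ => p.2) 2 π := by
  rw [← hπ.2] at hβ
  exact hβ.comp_of_map (by fun_prop)

lemma integrable_quadratic_of_mem_couplings [IsProbabilityMeasure α] (hα : MemLp id 2 α)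
    (hβ : MemLp id 2 β) (hπ : π ∈ couplings α β) (A B C D E F : ℝ) :
    Integrable (fun p : ℝ × ℝ =>
      A * p.1 ^ 2 + B * p.2 ^ 2 + C * (p.1 * p.2) + D * p.1 + E * p.2 + F) π := by
  have := isProbabilityMeasure_of_mem_couplings hπ
  exact integrable_quadratic (memLp_fst_of_mem_couplings hα hπ)
    (memLp_snd_of_mem_couplings hβ hπ) A B C D E F

lemma integrable_cost_of_mem_couplings [IsProbabilityMeasure α] (hα : MemLp id 2 α)
    (hβ : MemLp id 2 β) (hπ : π ∈ couplings α β) :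
    Integrable (fun p : ℝ × ℝ => (p.1 - p.2) ^ 2) π := by
  convert integrable_quadratic_of_mem_couplings hα hβ hπ 1 1 (-2) 0 0 0 using 2 with p
  ring

lemma integrable_quadratic_id [IsFiniteMeasure α] (hα : MemLp id 2 α) (A B C : ℝ) :
    Integrable (fun x : ℝ => A * x ^ 2 + B * x + C) α := by
  have i1 : Integrable (fun x : ℝ => x) α := hα.integrable (by norm_num)
  have i2 : Integrable (fun x : ℝ => x ^ 2) α := hα.integrable_sq
  exact ((i2.const_mul A).add (i1.const_mul B)).add (integrable_const C)

lemma entropicOT_ne_top [IsProbabilityMeasure α] [IsProbabilityMeasure β] (hε : 0 ≤ ε)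
    (hα : MemLp id 2 α) (hβ : MemLp id 2 β) : entropicOT ε α β ≠ ⊤ := by
  have hπ : α.prod β ∈ couplings α β := by
    constructor <;> simp [Measure.map_fst_prod, Measure.map_snd_prod]
  exact (entropicOT_le_of_coupling hε hπ (integrable_cost_of_mem_couplings hα hβ hπ)
    (by simp)).1

end EntropicOT

/-! ### Gaussian Schrödinger potentials and duality bounds. -/

section GaussianDensity

/-- The right side of `h` is the log-ratio of the two Gaussian densities. Leaving `φ` free lets
later kernels enter through an algebraic identity. -/
lemma expDensity_gaussianReal {m₁ m₂ v₁ v₂ : ℝ} (h₁ : 0 < v₁) (h₂ : 0 < v₂) {φ : ℝ → ℝ}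
    (h : ∀ x, φ x = Real.log (v₂ / v₁) / 2 - (x - m₁) ^ 2 / (2 * v₁)
      + (x - m₂) ^ 2 / (2 * v₂)) :
    expDensity (gaussianReal m₂ v₂.toNNReal) φ = gaussianReal m₁ v₁.toNNReal := by
  obtain rfl : φ = _ := funext h
  have hpos {v : ℝ} (hv : 0 < v) : (√(2 * Real.pi * v))⁻¹ =
      Real.exp (-(Real.log (2 * Real.pi) + Real.log v) / 2) := by
    rw [← Real.log_mul (by positivity) hv.ne', neg_div, Real.exp_neg, Real.exp_half,
      Real.exp_log (by positivity)]
  rw [gaussianReal_of_var_ne_zero _ (by simpa using h₂),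
    gaussianReal_of_var_ne_zero _ (by simpa using h₁), expDensity,
    ← withDensity_mul _ (by fun_prop) (by fun_prop)]
  congr 1
  ext x
  rw [Pi.mul_apply, gaussianPDF, gaussianPDF, ← ENNReal.ofReal_mul (gaussianPDFReal_nonneg _ _ _),
    gaussianPDFReal, gaussianPDFReal, Real.coe_toNNReal _ h₁.le, Real.coe_toNNReal _ h₂.le,
    hpos h₁, hpos h₂, ← Real.exp_add, ← Real.exp_add, ← Real.exp_add,
    Real.log_div h₂.ne' h₁.ne']
  congr 2
  ring

lemma lintegral_exp_gaussianReal {m₁ m₂ v₁ v₂ : ℝ} (h₁ : 0 < v₁) (h₂ : 0 < v₂) {φ : ℝ → ℝ}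
    (h : ∀ x, φ x = Real.log (v₂ / v₁) / 2 - (x - m₁) ^ 2 / (2 * v₁)
      + (x - m₂) ^ 2 / (2 * v₂)) :
    ∫⁻ x, ENNReal.ofReal (Real.exp (φ x)) ∂(gaussianReal m₂ v₂.toNNReal) = 1 := by
  have := measure_univ (μ := gaussianReal m₁ v₁.toNNReal)
  rwa [← expDensity_gaussianReal h₁ h₂ h, expDensity, withDensity_apply _ MeasurableSet.univ,
    Measure.restrict_univ] at this

/-- The log-density, with respect to the product, of the optimal entropic coupling of the
Gaussian measures `N(m₁, a)` and `N(m₂, b)`; `c` is the covariance of that coupling. -/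
noncomputable def logKernel (e a b c m₁ m₂ : ℝ) (p : ℝ × ℝ) : ℝ :=
  Real.log (a * b / (e * c)) / 2 - c / (2 * a * e) * (p.1 - m₁) ^ 2
    - c / (2 * b * e) * (p.2 - m₂) ^ 2 + (p.1 - m₁) * (p.2 - m₂) / e

/-- The Schrödinger potential on the side of the second marginal, up to a constant. -/
noncomputable def sndPotential (b c m₁ m₂ y : ℝ) : ℝ :=
  (1 - c / b) * (y - m₂) ^ 2 - 2 * (m₁ - m₂) * (y - m₂)

/-- The Schrödinger potential on the side of the first marginal. -/
noncomputable def fstPotential (e a b c m₁ m₂ x : ℝ) : ℝ :=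
  (1 - c / a) * (x - m₁) ^ 2 + 2 * (m₁ - m₂) * (x - m₁) + (m₁ - m₂) ^ 2
    + e * Real.log (a * b / (e * c))

@[fun_prop]
lemma measurable_logKernel (e a b c m₁ m₂ : ℝ) : Measurable (logKernel e a b c m₁ m₂) := by
  unfold logKernel; fun_prop

lemma logKernel_swap (e a b c m₁ m₂ x y : ℝ) :
    logKernel e a b c m₁ m₂ (x, y) = logKernel e b a c m₂ m₁ (y, x) := by
  simp only [logKernel, mul_comm a b]
  ring

variable {e a b c : ℝ} (m₁ m₂ : ℝ)

/-- The Schrödinger optimality condition, with ε = 2e: the mixed terms cancel. -/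
lemma cost_add_logKernel (he : 0 < e) (ha : 0 < a) (hb : 0 < b) (p : ℝ × ℝ) :
    (p.1 - p.2) ^ 2 + 2 * e * logKernel e a b c m₁ m₂ p
      = fstPotential e a b c m₁ m₂ p.1 + sndPotential b c m₁ m₂ p.2 := by
  simp only [logKernel, fstPotential, sndPotential]
  field_simp
  ring

/-- The integrand is the density of the conditional law of x given y: regression slope c/b and
variance a - c²/b, which equals ec/b by `h`. It holds for every y, so the law of y may later be
arbitrary. -/
lemma lintegral_exp_logKernel_fst (he : 0 < e) (ha : 0 < a) (hb : 0 < b) (hc : 0 < c)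
    (h : c ^ 2 + e * c = a * b) (y : ℝ) :
    ∫⁻ x, ENNReal.ofReal (Real.exp (logKernel e a b c m₁ m₂ (x, y)))
      ∂(gaussianReal m₁ a.toNNReal) = 1 := by
  refine lintegral_exp_gaussianReal (m₁ := m₁ + c / b * (y - m₂)) (v₁ := e * c / b)
    (by positivity) ha fun x => ?_
  have h1 : a / (e * c / b) = a * b / (e * c) := by field_simp
  rw [logKernel, h1]
  generalize Real.log (a * b / (e * c)) = L
  obtain rfl : a = (c ^ 2 + e * c) / b := by rw [h]; field_simp
  have : c + e ≠ 0 := by positivity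
  field_simp
  ring

lemma lintegral_exp_logKernel_snd (he : 0 < e) (ha : 0 < a) (hb : 0 < b) (hc : 0 < c)
    (h : c ^ 2 + e * c = a * b) (x : ℝ) :
    ∫⁻ y, ENNReal.ofReal (Real.exp (logKernel e a b c m₁ m₂ (x, y)))
      ∂(gaussianReal m₂ b.toNNReal) = 1 := by
  simp_rw [logKernel_swap e a b c m₁ m₂]
  exact lintegral_exp_logKernel_fst m₂ m₁ he hb ha hc (by rw [h, mul_comm]) x

lemma integrable_logKernel {α β : Measure ℝ} {π : Measure (ℝ × ℝ)} [IsProbabilityMeasure α]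
    (hα : MemLp id 2 α) (hβ : MemLp id 2 β) (hπ : π ∈ couplings α β) :
    Integrable (logKernel e a b c m₁ m₂) π := by
  convert integrable_quadratic_of_mem_couplings hα hβ hπ (-(c / (2 * a * e))) (-(c / (2 * b * e)))
    (1 / e) (c / (a * e) * m₁ - m₂ / e) (c / (b * e) * m₂ - m₁ / e)
    (Real.log (a * b / (e * c)) / 2 - c / (2 * a * e) * m₁ ^ 2 - c / (2 * b * e) * m₂ ^ 2
      + m₁ * m₂ / e) using 2 with p
  simp only [logKernel]
  ring

lemma integrable_sndPotential {β : Measure ℝ} [IsFiniteMeasure β] (hβ : MemLp id 2 β) :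
    Integrable (sndPotential b c m₁ m₂) β := by
  convert integrable_quadratic_id hβ (1 - c / b) (-2 * (1 - c / b) * m₂ - 2 * (m₁ - m₂))
    ((1 - c / b) * m₂ ^ 2 + 2 * (m₁ - m₂) * m₂) using 2 with p
  simp only [sndPotential]
  ring

lemma integrable_fstPotential {α : Measure ℝ} [IsFiniteMeasure α] (hα : MemLp id 2 α) :
    Integrable (fstPotential e a b c m₁ m₂) α := by
  convert integrable_quadratic_id hα (1 - c / a) (-2 * (1 - c / a) * m₁ + 2 * (m₁ - m₂))
    ((1 - c / a) * m₁ ^ 2 - 2 * (m₁ - m₂) * m₁ + (m₁ - m₂) ^ 2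
      + e * Real.log (a * b / (e * c))) using 2 with p
  simp only [fstPotential]
  ring

lemma integral_cost_add_integral_logKernel {α β : Measure ℝ} {π : Measure (ℝ × ℝ)}
    [IsProbabilityMeasure α] [IsProbabilityMeasure β]
    (he : 0 < e) (ha : 0 < a) (hb : 0 < b) (hα : MemLp id 2 α) (hβ : MemLp id 2 β)
    (hπ : π ∈ couplings α β) :
    ∫ p, (p.1 - p.2) ^ 2 ∂π + 2 * e * ∫ p, logKernel e a b c m₁ m₂ p ∂π
      = ∫ x, fstPotential e a b c m₁ m₂ x ∂α + ∫ y, sndPotential b c m₁ m₂ y ∂β := by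
  have hi := integrable_cost_of_mem_couplings hα hβ hπ
  have hl : Integrable (logKernel e a b c m₁ m₂) π := integrable_logKernel m₁ m₂ hα hβ hπ
  have hF : Integrable (fstPotential e a b c m₁ m₂) (π.map Prod.fst) := by
    rw [hπ.1]; exact integrable_fstPotential m₁ m₂ hα
  have hG : Integrable (sndPotential b c m₁ m₂) (π.map Prod.snd) := by
    rw [hπ.2]; exact integrable_sndPotential m₁ m₂ hβ
  rw [← integral_const_mul, ← integral_add hi (hl.const_mul _)]
  simp_rw [cost_add_logKernel m₁ m₂ he ha hb]
  have hF' : Integrable (fun p : ℝ × ℝ => fstPotential e a b c m₁ m₂ p.1) π :=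
    hF.comp_measurable measurable_fst
  have hG' : Integrable (fun p : ℝ × ℝ => sndPotential b c m₁ m₂ p.2) π :=
    hG.comp_measurable measurable_snd
  rw [integral_add hF' hG']
  conv_rhs => rw [← hπ.1, ← hπ.2]
  rw [integral_map (by fun_prop) hF.aestronglyMeasurable,
    integral_map (by fun_prop) hG.aestronglyMeasurable]

lemma memLp_two_gaussianReal (m : ℝ) (v : NNReal) : MemLp id 2 (gaussianReal m v) := by
  exact_mod_cast memLp_id_gaussianReal (μ := m) (v := v) 2

/-- Lower bound for the entropic transport cost from a Gaussian measure. -/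
lemma le_entropicOT_gaussianReal {β : Measure ℝ} [IsProbabilityMeasure β]
    (he : 0 < e) (ha : 0 < a) (hb : 0 < b) (hc : 0 < c) (h : c ^ 2 + e * c = a * b)
    (hβ : MemLp id 2 β) :
    ∫ x, fstPotential e a b c m₁ m₂ x ∂(gaussianReal m₁ a.toNNReal)
        + ∫ y, sndPotential b c m₁ m₂ y ∂β
      ≤ (entropicOT (2 * e) (gaussianReal m₁ a.toNNReal) β).toReal := by
  have hα := memLp_two_gaussianReal m₁ a.toNNReal
  refine le_toReal_entropicOT (by positivity) (entropicOT_ne_top (by positivity) hα hβ) ?_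
  intro π hπ hi hk
  have := isProbabilityMeasure_of_mem_couplings hπ
  have hl : Integrable (logKernel e a b c m₁ m₂) π := integrable_logKernel m₁ m₂ hα hβ hπ
  have hm := measurable_logKernel e a b c m₁ m₂
  -- Integrating x first gives 1 for each y, whatever `β` is.
  have hp : IsProbabilityMeasure (expDensity ((gaussianReal m₁ a.toNNReal).prod β)
      (logKernel e a b c m₁ m₂)) := by
    refine isProbabilityMeasure_expDensity ?_
    rw [lintegral_prod_symm' _ (by fun_prop)]
    simp [lintegral_exp_logKernel_fst m₁ m₂ he ha hb hc h]
  rw [← integral_cost_add_integral_logKernel m₁ m₂ he ha hb hα hβ hπ]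
  have := integral_le_toReal_klDiv hm hl hk
  gcongr

/-- When both marginals are Gaussian the kernel defines a genuine coupling, for which the Gibbs
inequality is an equality. -/
lemma entropicOT_gaussianReal_le (he : 0 < e) (ha : 0 < a) (hb : 0 < b) (hc : 0 < c)
    (h : c ^ 2 + e * c = a * b) :
    (entropicOT (2 * e) (gaussianReal m₁ a.toNNReal) (gaussianReal m₂ b.toNNReal)).toReal
      ≤ ∫ x, fstPotential e a b c m₁ m₂ x ∂(gaussianReal m₁ a.toNNReal)
        + ∫ y, sndPotential b c m₁ m₂ y ∂(gaussianReal m₂ b.toNNReal) := by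
  have hα := memLp_two_gaussianReal m₁ a.toNNReal
  have hβ := memLp_two_gaussianReal m₂ b.toNNReal
  have h1 := lintegral_exp_logKernel_fst m₁ m₂ he ha hb hc h
  have h2 := lintegral_exp_logKernel_snd m₁ m₂ he ha hb hc h
  set α := gaussianReal m₁ a.toNNReal
  set β := gaussianReal m₂ b.toNNReal
  have hm := measurable_logKernel e a b c m₁ m₂
  have hp : IsProbabilityMeasure (expDensity (α.prod β) (logKernel e a b c m₁ m₂)) :=
    isProbabilityMeasure_expDensity_prod hm h2
  have hπ : expDensity (α.prod β) (logKernel e a b c m₁ m₂) ∈ couplings α β := by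
    refine ⟨map_fst_expDensity_prod hm h2, ?_⟩
    rw [map_snd_expDensity_prod hm]
    simp_rw [h1]
    exact withDensity_one
  have hl : Integrable (logKernel e a b c m₁ m₂) _ := integrable_logKernel m₁ m₂ hα hβ hπ
  refine (entropicOT_le_of_coupling (by positivity) hπ
    (integrable_cost_of_mem_couplings hα hβ hπ) (klDiv_expDensity_ne_top hm hl)).2.trans ?_
  rw [toReal_klDiv_expDensity hm, integral_cost_add_integral_logKernel m₁ m₂ he ha hb hα hβ hπ]

end GaussianDensity

/-! ### The Gaussian noise channel, the self-cost bound and deconvolution. -/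

section GaussianChannel

/-- The log-density of `N(x, t)` with respect to `N(m, s)` at `z`, as a function of `(x, z)`. -/
noncomputable def channelLogDensity (t m s : ℝ) (p : ℝ × ℝ) : ℝ :=
  Real.log (s / t) / 2 - (p.2 - p.1) ^ 2 / (2 * t) + (p.2 - m) ^ 2 / (2 * s)

@[fun_prop]
lemma measurable_channelLogDensity (t m s : ℝ) : Measurable (channelLogDensity t m s) := by
  unfold channelLogDensity; fun_prop

variable {β : Measure ℝ} {t m s : ℝ}

lemma lintegral_exp_channelLogDensity (ht : 0 < t) (hs : 0 < s) (x : ℝ) :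
    ∫⁻ z, ENNReal.ofReal (Real.exp (channelLogDensity t m s (x, z)))
      ∂(gaussianReal m s.toNNReal) = 1 :=
  lintegral_exp_gaussianReal ht hs fun _ => rfl

lemma expDensity_channelLogDensity [SFinite β] (ht : 0 < t) (hs : 0 < s) :
    expDensity (β.prod (gaussianReal m s.toNNReal)) (channelLogDensity t m s)
      = (β.prod (gaussianReal 0 t.toNNReal)).map (fun p => (p.1, p.1 + p.2)) := by
  have hm := measurable_channelLogDensity t m s
  refine Measure.ext_of_lintegral _ fun f hf => ?_
  rw [lintegral_expDensity hm hf, lintegral_map hf (by fun_prop), lintegral_prod _ (by fun_prop),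
    lintegral_prod _ (by fun_prop)]
  refine lintegral_congr fun x => ?_
  have h : expDensity (gaussianReal m s.toNNReal) (fun z => channelLogDensity t m s (x, z))
      = gaussianReal x t.toNNReal := expDensity_gaussianReal ht hs fun _ => rfl
  rw [← lintegral_expDensity (ν := gaussianReal m s.toNNReal)
    (φ := fun z => channelLogDensity t m s (x, z)) (f := fun z => f (x, z))
    (by fun_prop) (by fun_prop), h]
  have h0 := gaussianReal_map_const_add (μ := 0) (v := t.toNNReal) x
  rw [zero_add] at h0
  rw [← h0, lintegral_map (by fun_prop) (by fun_prop)]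

lemma map_snd_expDensity_channelLogDensity [SFinite β] (ht : 0 < t) (hs : 0 < s) :
    (expDensity (β.prod (gaussianReal m s.toNNReal)) (channelLogDensity t m s)).map Prod.snd
      = β ∗ gaussianReal 0 t.toNNReal := by
  rw [expDensity_channelLogDensity ht hs, Measure.map_map (by fun_prop) (by fun_prop)]
  rfl

lemma integrable_channelLogDensity [IsProbabilityMeasure β] (ht : 0 < t) (hs : 0 < s)
    (hβ : MemLp id 2 β) :
    Integrable (channelLogDensity t m s)
      (expDensity (β.prod (gaussianReal m s.toNNReal)) (channelLogDensity t m s)) := by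
  rw [expDensity_channelLogDensity ht hs]
  have h1 : MemLp (fun p : ℝ × ℝ => p.1) 2 (β.prod (gaussianReal 0 t.toNNReal)) :=
    hβ.comp_fst _
  have h2 : MemLp (fun p : ℝ × ℝ => p.2) 2 (β.prod (gaussianReal 0 t.toNNReal)) :=
    (memLp_two_gaussianReal 0 t.toNNReal).comp_snd _
  rw [integrable_map_measure (by fun_prop) (by fun_prop)]
  convert integrable_quadratic h1 h2 (1 / (2 * s)) (1 / (2 * s) - 1 / (2 * t)) (1 / s)
    (- m / s) (- m / s) (m ^ 2 / (2 * s) + Real.log (s / t) / 2) using 2 with p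
  simp only [channelLogDensity, Function.comp_apply]
  ring

/-- The self-transport cost of `β` is at most the self-transport potential of `N(m, b)` integrated
against `β`, minus the relative entropy of the Gaussian smoothings. -/
lemma entropicOT_self_le [IsProbabilityMeasure β] {e b c : ℝ} (he : 0 < e) (hb : 0 < b) (hc : 0 < c)
    (h : c ^ 2 + e * c = b * b) (hβ : MemLp id 2 β) :
    klDiv (β ∗ gaussianReal 0 (c + e - b).toNNReal) (gaussianReal m (c + e).toNNReal) ≠ ⊤ ∧
    (entropicOT (2 * e) β β).toReal
      ≤ ∫ x, fstPotential e b b c m m x ∂β + ∫ y, sndPotential b c m m y ∂β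
        - 2 * e * (klDiv (β ∗ gaussianReal 0 (c + e - b).toNNReal)
          (gaussianReal m (c + e).toNNReal)).toReal := by
  have hbs : b < c + e := by nlinarith
  have ht : 0 < c + e - b := by linarith
  have hs : 0 < c + e := by positivity
  -- The self-kernel factors through the channel. For input N(m, b) and noise t the output variance
  -- is s = b + t, and the posterior coupling has covariance b²/s; it equals c exactly when s = c +
  -- e. Given x and y, the precision of z is 2/t - 1/s = (s + b)/(ts), whence `v₁`.
  have h2 : ∀ x y, ∫⁻ z, ENNReal.ofReal (Real.exp (channelLogDensity (c + e - b) m (c + e) (x, z)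
      + channelLogDensity (c + e - b) m (c + e) (y, z) - logKernel e b b c m m (x, y)))
        ∂(gaussianReal m (c + e).toNNReal) = 1 := by
    intro x y
    refine lintegral_exp_gaussianReal
      (m₁ := m + (c + e) / (c + e + b) * ((x - m) + (y - m)))
      (v₁ := (c + e - b) * (c + e) / (c + e + b)) (by positivity) hs fun z => ?_
    have hlog : Real.log ((c + e) / (c + e - b)) * 2 = Real.log (b * b / (e * c))
        + Real.log ((c + e) / ((c + e - b) * (c + e) / (c + e + b))) := by
      have h4 : c + e - b ≠ 0 := ht.ne'
      rw [mul_two, ← Real.log_mul (by positivity) (by positivity),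
        ← Real.log_mul (by positivity) (by positivity), ← h]
      congr 1
      field_simp
      linear_combination -h
    simp only [channelLogDensity, logKernel]
    generalize Real.log ((c + e) / (c + e - b)) = L1 at *
    generalize Real.log (b * b / (e * c)) = L2 at *
    generalize Real.log ((c + e) / ((c + e - b) * (c + e) / (c + e + b))) = L3 at *
    obtain rfl : L3 = L1 * 2 - L2 := by linarith
    -- Taking `S` (the output variance) and `b` as free parameters makes the claim a rational
    -- identity.
    generalize hS : c + e = S at *
    obtain rfl : c = b * b / S := by rw [← h, ← hS]; field_simp
    obtain rfl : e = (S - b) * (S + b) / S := by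
      field_simp; field_simp at hS; linarith
    have h3 : S + b ≠ 0 := by positivity
    have h4 : S - b ≠ 0 := ht.ne'
    field_simp
    ring
  obtain ⟨hk, π, hπ1, hπ2, hπk, hle⟩ := exists_posterior_coupling (β := β)
    (measurable_channelLogDensity (c + e - b) m (c + e)) (lintegral_exp_channelLogDensity ht hs)
    (integrable_channelLogDensity ht hs hβ) (measurable_logKernel e b b c m m) h2
    (fun π h1 h2 => integrable_logKernel m m hβ hβ ⟨h1, h2⟩)
  rw [map_snd_expDensity_channelLogDensity ht hs] at hk hle
  refine ⟨hk, ?_⟩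
  have hπ : π ∈ couplings β β := ⟨hπ1, hπ2⟩
  refine (entropicOT_le_of_coupling (by positivity) hπ
    (integrable_cost_of_mem_couplings hβ hβ hπ) hπk).2.trans ?_
  rw [← integral_cost_add_integral_logKernel m m he hb hb hβ hβ hπ, add_sub_assoc, ← mul_sub]
  gcongr

/-- The Gaussian characteristic function never vanishes, so it can be cancelled. -/
lemma eq_gaussianReal_of_conv_eq [IsProbabilityMeasure β] {b : ℝ} (hb : 0 ≤ b) (ht : 0 ≤ t)
    (h : β ∗ gaussianReal 0 t.toNNReal = gaussianReal m (b + t).toNNReal) :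
    β = gaussianReal m b.toNNReal := by
  have h' : gaussianReal m b.toNNReal ∗ gaussianReal 0 t.toNNReal
      = gaussianReal m (b + t).toNNReal := by
    rw [gaussianReal_conv_gaussianReal, add_zero, Real.toNNReal_add hb ht]
  refine Measure.ext_of_charFun ?_
  ext u
  have := congrArg (fun ν => charFun ν u) (h.trans h'.symm)
  simp only [charFun_conv] at this
  refine mul_right_cancel₀ ?_ this
  rw [charFun_gaussianReal]
  exact Complex.exp_ne_zero _

end GaussianChannel

/-! ### Sub-Gaussian measures. -/

section SubGaussian

lemma memLp_two_of_mem_subGaussian {α : Measure ℝ} (hα : α ∈ subGaussian) : MemLp id 2 α := by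
  obtain ⟨hp, q, hq, h⟩ := hα
  refine (memLp_two_iff_integrable_sq (by fun_prop)).2 ?_
  have hi : Integrable (fun x : ℝ => Real.exp (x ^ 2 / (2 * q ^ 2))) α := by
    refine ⟨by fun_prop, ?_⟩
    rw [hasFiniteIntegral_iff_ofReal (Filter.Eventually.of_forall fun x => (Real.exp_pos _).le)]
    exact h.trans_lt (by norm_num)
  refine (hi.const_mul (2 * q ^ 2)).mono' (by fun_prop) (Filter.Eventually.of_forall fun x => ?_)
  rw [Real.norm_of_nonneg (by positivity)]
  have := Real.add_one_le_exp (x ^ 2 / (2 * q ^ 2))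
  calc (id x) ^ 2 = 2 * q ^ 2 * (x ^ 2 / (2 * q ^ 2)) := by simp only [id]; field_simp
    _ ≤ _ := by gcongr; linarith

/-- Fernique's theorem gives integrability of some exp(C x²) but not the bound 2; as q = n + 1
grows, the integral tends to 1 by dominated convergence. -/
lemma gaussianReal_mem_subGaussian (m : ℝ) (v : NNReal) : gaussianReal m v ∈ subGaussian := by
  refine ⟨inferInstance, ?_⟩
  obtain ⟨C, hC, hi⟩ := IsGaussian.exists_integrable_exp_sq (gaussianReal m v)
  simp only [Real.norm_eq_abs, sq_abs] at hi
  have hbound : ∀ᶠ n : ℕ in Filter.atTop, ∀ x : ℝ,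
      ‖Real.exp (x ^ 2 / (2 * ((n : ℝ) + 1) ^ 2))‖ ≤ Real.exp (C * x ^ 2) := by
    obtain ⟨N, hN⟩ := exists_nat_gt (1 / C)
    filter_upwards [Filter.eventually_ge_atTop N] with n hn x
    rw [Real.norm_of_nonneg (Real.exp_pos _).le]
    gcongr
    have h1 : (1 : ℝ) / C < n := hN.trans_le (by exact_mod_cast hn)
    rw [div_lt_iff₀ hC] at h1
    rw [div_le_iff₀ (by positivity)]
    have h3 : (0 : ℝ) ≤ C * n := by positivity
    have h2 : 1 ≤ C * (2 * ((n : ℝ) + 1) ^ 2) := by nlinarith [mul_nonneg hC.le (sq_nonneg (n : ℝ))]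
    nlinarith [sq_nonneg x]
  have hlim : Filter.Tendsto
      (fun n : ℕ => ∫ x, Real.exp (x ^ 2 / (2 * ((n : ℝ) + 1) ^ 2)) ∂(gaussianReal m v))
      Filter.atTop (nhds (∫ _, (1 : ℝ) ∂(gaussianReal m v))) := by
    refine tendsto_integral_filter_of_dominated_convergence _ ?_ ?_ hi ?_
    · exact Filter.Eventually.of_forall fun n => by fun_prop
    · exact hbound.mono fun n hn => Filter.Eventually.of_forall hn
    · refine Filter.Eventually.of_forall fun x => ?_
      have h1 : Filter.Tendsto (fun n : ℕ => x ^ 2 / (2 * ((n : ℝ) + 1) ^ 2)) Filter.atTop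
          (nhds 0) := by
        refine Filter.Tendsto.const_div_atTop ?_ _
        refine Filter.Tendsto.const_mul_atTop two_pos ?_
        exact (Filter.tendsto_pow_atTop two_ne_zero).comp
          (Filter.tendsto_atTop_add_const_right _ _ tendsto_natCast_atTop_atTop)
      have h2 := (Real.continuous_exp.tendsto 0).comp h1
      rwa [Real.exp_zero] at h2
  have hone : ∫ _ : ℝ, (1 : ℝ) ∂(gaussianReal m v) < 2 := by simp
  obtain ⟨n, hn, hn'⟩ := ((hlim.eventually (gt_mem_nhds hone)).and hbound).exists
  refine ⟨n + 1, by positivity, ?_⟩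
  rw [← ofReal_integral_eq_lintegral_ofReal
    (hi.mono' (by fun_prop) (Filter.Eventually.of_forall hn'))
    (Filter.Eventually.of_forall fun x => (Real.exp_pos _).le)]
  exact (ENNReal.ofReal_le_ofReal hn.le).trans (by simp)

end SubGaussian

/-! ### The scalar fixed point equation. -/

section FixedPoint

variable {K : ℕ} {e : ℝ} {w σ : Fin K → ℝ}

lemma fixedPoint_unique_aux (he : 0 < e) (hw : ∀ k, 0 < w k) (hw1 : ∑ k, w k = 1) {S T : ℝ}
    (hS : 0 < S) (hST : S < T)
    (h1 : ∑ k, w k * √(e ^ 2 + 4 * σ k ^ 2 * S ^ 2) = √(e ^ 2 + 4 * S ^ 4))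
    (h2 : ∑ k, w k * √(e ^ 2 + 4 * σ k ^ 2 * T ^ 2) = √(e ^ 2 + 4 * T ^ 4)) : False := by
  have hT : 0 < T := hS.trans hST
  obtain ⟨l, hl⟩ : ∃ l, l = S ^ 2 / T ^ 2 := ⟨_, rfl⟩
  have hl0 : 0 < l := by rw [hl]; positivity
  have hl1 : l < 1 := by rw [hl, div_lt_one (by positivity)]; gcongr
  have hS2 : S ^ 2 = l * T ^ 2 := by rw [hl]; field_simp
  have hS4 : S ^ 4 = l ^ 2 * T ^ 4 := by rw [show S ^ 4 = (S ^ 2) ^ 2 by ring, hS2]; ring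
  -- S² = l T² lies between 0 and T²: the concave left terms lie above their chord from the value
  -- `e` at 0, the strictly convex right side below its own.
  have hconc : ∀ k, (1 - l) * e + l * √(e ^ 2 + 4 * σ k ^ 2 * T ^ 2)
      ≤ √(e ^ 2 + 4 * σ k ^ 2 * S ^ 2) := by
    intro k
    refine Real.le_sqrt_of_sq_le ?_
    have hr := Real.sq_sqrt (show 0 ≤ e ^ 2 + 4 * σ k ^ 2 * T ^ 2 by positivity)
    generalize √(e ^ 2 + 4 * σ k ^ 2 * T ^ 2) = r at hr ⊢
    rw [hS2]
    nlinarith [mul_nonneg (mul_nonneg hl0.le (sub_nonneg.2 hl1.le)) (sq_nonneg (r - e))]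
  have hconv : √(e ^ 2 + 4 * S ^ 4) < (1 - l) * e + l * √(e ^ 2 + 4 * T ^ 4) := by
    have hr := Real.sq_sqrt (show 0 ≤ e ^ 2 + 4 * T ^ 4 by positivity)
    have her : e < √(e ^ 2 + 4 * T ^ 4) := Real.lt_sqrt_of_sq_lt (by nlinarith [pow_pos hT 4])
    generalize √(e ^ 2 + 4 * T ^ 4) = r at hr her ⊢
    have h1l : 0 < 1 - l := sub_pos.2 hl1
    have hr0 : 0 < r := he.trans her
    rw [Real.sqrt_lt' (by positivity), hS4]
    nlinarith [mul_pos (mul_pos (mul_pos hl0 h1l) he) (sub_pos.2 her)]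
  have hsum : (1 - l) * e + l * √(e ^ 2 + 4 * T ^ 4) ≤ √(e ^ 2 + 4 * S ^ 4) := by
    rw [← h1, ← h2, Finset.mul_sum]
    calc (1 - l) * e + ∑ k, l * (w k * √(e ^ 2 + 4 * σ k ^ 2 * T ^ 2))
        = ∑ k, w k * ((1 - l) * e + l * √(e ^ 2 + 4 * σ k ^ 2 * T ^ 2)) := by
          simp_rw [mul_add, Finset.sum_add_distrib, ← Finset.sum_mul, hw1, one_mul]
          congr 1
          exact Finset.sum_congr rfl fun k _ => by ring
      _ ≤ _ := Finset.sum_le_sum fun k _ => mul_le_mul_of_nonneg_left (hconc k) (hw k).le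
  exact absurd hconv (not_lt.2 hsum)

lemma fixedPoint_unique (he : 0 < e) (hw : ∀ k, 0 < w k) (hw1 : ∑ k, w k = 1) {S T : ℝ}
    (hS : 0 < S) (hT : 0 < T)
    (h1 : ∑ k, w k * √(e ^ 2 + 4 * σ k ^ 2 * S ^ 2) = √(e ^ 2 + 4 * S ^ 4))
    (h2 : ∑ k, w k * √(e ^ 2 + 4 * σ k ^ 2 * T ^ 2) = √(e ^ 2 + 4 * T ^ 4)) : T = S := by
  rcases lt_trichotomy S T with h | h | h
  · exact (fixedPoint_unique_aux he hw hw1 hS h h1 h2).elim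
  · exact h.symm
  · exact (fixedPoint_unique_aux he hw hw1 hT h h2 h1).elim

lemma sum_sub_sqrt (hw1 : ∑ k, w k = 1) (S : ℝ) :
    ∑ k, w k * (√(e ^ 2 + 4 * σ k ^ 2 * S ^ 2) - √(e ^ 2 + 4 * S ^ 4))
      = ∑ k, w k * √(e ^ 2 + 4 * σ k ^ 2 * S ^ 2) - √(e ^ 2 + 4 * S ^ 4) := by
  simp_rw [mul_sub, Finset.sum_sub_distrib, ← Finset.sum_mul, hw1, one_mul]

lemma sqrt_le_sqrt_of_le {s S : ℝ} (hS : 0 < S) (h : S ≤ s) :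
    √(e ^ 2 + 4 * S ^ 4) ≤ √(e ^ 2 + 4 * s ^ 2 * S ^ 2) := by
  apply Real.sqrt_le_sqrt
  have : S ^ 2 ≤ s ^ 2 := by gcongr
  nlinarith [mul_le_mul_of_nonneg_right this (sq_nonneg S)]

lemma sqrt_le_sqrt_of_ge {s S : ℝ} (hs : 0 < s) (h : s ≤ S) :
    √(e ^ 2 + 4 * s ^ 2 * S ^ 2) ≤ √(e ^ 2 + 4 * S ^ 4) := by
  apply Real.sqrt_le_sqrt
  have : s ^ 2 ≤ S ^ 2 := by gcongr
  nlinarith [mul_le_mul_of_nonneg_right this (sq_nonneg S)]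

lemma eq_of_sqrt_eq_sqrt {s S : ℝ} (hs : 0 < s) (hS : 0 < S)
    (h : √(e ^ 2 + 4 * s ^ 2 * S ^ 2) = √(e ^ 2 + 4 * S ^ 4)) : s = S := by
  rw [Real.sqrt_inj (by positivity) (by positivity)] at h
  have : s ^ 2 = S ^ 2 := by
    have h2 : s ^ 2 * S ^ 2 = S ^ 2 * S ^ 2 := by linarith [h]
    exact mul_right_cancel₀ (by positivity) h2
  exact (pow_left_inj₀ hs.le hS.le two_ne_zero).1 this

lemma exists_fixedPoint (hw : ∀ k, 0 < w k) (hw1 : ∑ k, w k = 1) (hσ : ∀ k, 0 < σ k) :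
    ∃ S, 0 < S ∧ ∑ k, w k * √(e ^ 2 + 4 * σ k ^ 2 * S ^ 2) = √(e ^ 2 + 4 * S ^ 4) ∧
      (⨅ k, σ k) ≤ S ∧ S ≤ ⨆ k, σ k := by
  have hne : Nonempty (Fin K) := by
    by_contra hemp
    rw [not_nonempty_iff] at hemp
    simp at hw1
  obtain ⟨i, hi⟩ := exists_eq_ciInf_of_finite (f := σ)
  obtain ⟨j, hj⟩ := exists_eq_ciSup_of_finite (f := σ)
  have hmin : ∀ k, σ i ≤ σ k := fun k => hi ▸ ciInf_le (Set.finite_range σ).bddBelow k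
  have hmax : ∀ k, σ k ≤ σ j := fun k => hj ▸ le_ciSup (Set.finite_range σ).bddAbove k
  have hcont : ContinuousOn (fun S : ℝ =>
      ∑ k, w k * (√(e ^ 2 + 4 * S ^ 4) - √(e ^ 2 + 4 * σ k ^ 2 * S ^ 2)))
      (Set.Icc (σ i) (σ j)) := by fun_prop
  have hmem : (0 : ℝ) ∈ Set.Icc
      (∑ k, w k * (√(e ^ 2 + 4 * σ i ^ 4) - √(e ^ 2 + 4 * σ k ^ 2 * σ i ^ 2)))
      (∑ k, w k * (√(e ^ 2 + 4 * σ j ^ 4) - √(e ^ 2 + 4 * σ k ^ 2 * σ j ^ 2))) := by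
    constructor
    · refine Finset.sum_nonpos fun k _ => mul_nonpos_of_nonneg_of_nonpos (hw k).le ?_
      exact sub_nonpos.2 (sqrt_le_sqrt_of_le (hσ i) (hmin k))
    · refine Finset.sum_nonneg fun k _ => mul_nonneg (hw k).le ?_
      exact sub_nonneg.2 (sqrt_le_sqrt_of_ge (hσ k) (hmax k))
  obtain ⟨S, ⟨hS1, hS2⟩, hS⟩ := intermediate_value_Icc (hmin j) hcont hmem
  refine ⟨S, (hσ i).trans_le hS1, ?_, hi ▸ hS1, hj ▸ hS2⟩
  simp_rw [mul_sub, Finset.sum_sub_distrib, ← Finset.sum_mul, hw1, one_mul] at hS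
  linarith

/-- If S were the minimum, the equation would be a vanishing sum of nonnegative terms, forcing every
σ_k to equal S. -/
lemma ciInf_lt_fixedPoint (hw : ∀ k, 0 < w k) (hw1 : ∑ k, w k = 1) (hσ : ∀ k, 0 < σ k)
    {S : ℝ} (hS0 : 0 < S)
    (hS : ∑ k, w k * √(e ^ 2 + 4 * σ k ^ 2 * S ^ 2) = √(e ^ 2 + 4 * S ^ 4))
    (hle : (⨅ k, σ k) ≤ S) (hne : ∃ i j, σ i ≠ σ j) : (⨅ k, σ k) < S := by
  refine lt_of_le_of_ne hle fun heq => ?_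
  have h0 := sum_sub_sqrt (e := e) (σ := σ) hw1 S
  rw [hS, sub_self, Finset.sum_eq_zero_iff_of_nonneg] at h0
  · obtain ⟨i, j, hij⟩ := hne
    have : ∀ k, σ k = S := fun k => by
      have := (mul_eq_zero.1 (h0 k (Finset.mem_univ k))).resolve_left (hw k).ne'
      exact eq_of_sqrt_eq_sqrt (hσ k) hS0 (sub_eq_zero.1 this)
    exact hij ((this i).trans (this j).symm)
  · intro k _
    refine mul_nonneg (hw k).le (sub_nonneg.2 (sqrt_le_sqrt_of_le hS0 ?_))
    rw [← heq]
    exact ciInf_le (Set.finite_range σ).bddBelow k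

lemma fixedPoint_lt_ciSup (hw : ∀ k, 0 < w k) (hw1 : ∑ k, w k = 1) (hσ : ∀ k, 0 < σ k)
    {S : ℝ} (hS0 : 0 < S)
    (hS : ∑ k, w k * √(e ^ 2 + 4 * σ k ^ 2 * S ^ 2) = √(e ^ 2 + 4 * S ^ 4))
    (hle : S ≤ ⨆ k, σ k) (hne : ∃ i j, σ i ≠ σ j) : S < ⨆ k, σ k := by
  refine lt_of_le_of_ne hle fun heq => ?_
  have h0 := sum_sub_sqrt (e := e) (σ := σ) hw1 S
  rw [hS, sub_self, Finset.sum_eq_zero_iff_of_nonpos] at h0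
  · obtain ⟨i, j, hij⟩ := hne
    have : ∀ k, σ k = S := fun k => by
      have := (mul_eq_zero.1 (h0 k (Finset.mem_univ k))).resolve_left (hw k).ne'
      exact eq_of_sqrt_eq_sqrt (hσ k) hS0 (sub_eq_zero.1 this)
    exact hij ((this i).trans (this j).symm)
  · intro k _
    refine mul_nonpos_of_nonneg_of_nonpos (hw k).le
      (sub_nonpos.2 (sqrt_le_sqrt_of_ge (hσ k) ?_))
    rw [heq]
    exact le_ciSup (Set.finite_range σ).bddAbove k

end FixedPoint

/-! ### Averaging the potentials and identifying the barycenter. -/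

section Barycenter

/-- The covariance of the optimal entropic coupling of two Gaussian measures with variances
`a` and `b`. -/
noncomputable def optCov (e a b : ℝ) : ℝ := (√(e ^ 2 + 4 * (a * b)) - e) / 2

lemma optCov_sq_add {e a b : ℝ} (ha : 0 < a) (hb : 0 < b) :
    optCov e a b ^ 2 + e * optCov e a b = a * b := by
  have := Real.sq_sqrt (show 0 ≤ e ^ 2 + 4 * (a * b) by positivity)
  simp only [optCov]
  linear_combination this / 4

lemma optCov_pos {e a b : ℝ} (ha : 0 < a) (hb : 0 < b) : 0 < optCov e a b := by
  have : e < √(e ^ 2 + 4 * (a * b)) :=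
    Real.lt_sqrt_of_sq_lt (by have := mul_pos ha hb; linarith)
  simp only [optCov]
  linarith

variable {K : ℕ} {e : ℝ} {w m σ : Fin K → ℝ} {S : ℝ}

/-- The covariance is affine in the square root, so this is the fixed point equation in another
form. -/
lemma sum_optCov (hw1 : ∑ k, w k = 1)
    (hS : ∑ k, w k * √(e ^ 2 + 4 * σ k ^ 2 * S ^ 2) = √(e ^ 2 + 4 * S ^ 4)) :
    ∑ k, w k * optCov e (σ k ^ 2) (S ^ 2) = optCov e (S ^ 2) (S ^ 2) := by
  have h1 : S ^ 2 * S ^ 2 = S ^ 4 := by ring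
  simp only [optCov, h1, ← hS, ← mul_assoc]
  simp_rw [mul_div_assoc', mul_sub, ← Finset.sum_div, Finset.sum_sub_distrib, ← Finset.sum_mul,
    hw1, one_mul]

lemma sum_sndPotential (hw1 : ∑ k, w k = 1)
    (hS : ∑ k, w k * √(e ^ 2 + 4 * σ k ^ 2 * S ^ 2) = √(e ^ 2 + 4 * S ^ 4)) (y : ℝ) :
    ∑ k, w k * sndPotential (S ^ 2) (optCov e (σ k ^ 2) (S ^ 2)) (m k) (∑ k, w k * m k) y
      = sndPotential (S ^ 2) (optCov e (S ^ 2) (S ^ 2)) (∑ k, w k * m k) (∑ k, w k * m k) y := by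
  generalize hM : ∑ k, w k * m k = M
  have : ∀ k, w k * sndPotential (S ^ 2) (optCov e (σ k ^ 2) (S ^ 2)) (m k) M y
      = w k * ((y - M) ^ 2 + 2 * M * (y - M))
        - w k * optCov e (σ k ^ 2) (S ^ 2) * ((y - M) ^ 2 / S ^ 2)
        - w k * m k * (2 * (y - M)) := fun k => by
    simp only [sndPotential]
    ring
  simp_rw [this, Finset.sum_sub_distrib, ← Finset.sum_mul, hw1, hM, sum_optCov hw1 hS,
    sndPotential]
  ring

lemma sum_sinkhornDiv {ε : ℝ} {a : Fin K → Measure ℝ} (hw1 : ∑ k, w k = 1) (β : Measure ℝ) :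
    ∑ k, w k * sinkhornDiv ε (a k) β
      = ∑ k, w k * (entropicOT ε (a k) β).toReal
        - ∑ k, w k * ((entropicOT ε (a k) (a k)).toReal / 2)
        - (entropicOT ε β β).toReal / 2 := by
  conv_rhs => rw [← one_mul ((entropicOT ε β β).toReal / 2), ← hw1, Finset.sum_mul]
  rw [← Finset.sum_sub_distrib, ← Finset.sum_sub_distrib]
  refine Finset.sum_congr rfl fun k _ => ?_
  rw [sinkhornDiv]
  ring

lemma fstPotential_self (b c M x : ℝ) :
    fstPotential e b b c M M x = sndPotential b c M M x + e * Real.log (b * b / (e * c)) := by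
  simp only [fstPotential, sndPotential]
  ring

lemma integral_fstPotential_self {β : Measure ℝ} [IsProbabilityMeasure β] (hβ : MemLp id 2 β)
    (b c M : ℝ) :
    ∫ x, fstPotential e b b c M M x ∂β
      = ∫ x, sndPotential b c M M x ∂β + e * Real.log (b * b / (e * c)) := by
  simp_rw [fstPotential_self]
  rw [integral_add (integrable_sndPotential M M hβ) (integrable_const _)]
  simp

lemma sum_integral_sndPotential {β : Measure ℝ} [IsProbabilityMeasure β] (hβ : MemLp id 2 β)
    (hw1 : ∑ k, w k = 1)
    (hS : ∑ k, w k * √(e ^ 2 + 4 * σ k ^ 2 * S ^ 2) = √(e ^ 2 + 4 * S ^ 4)) :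
    ∑ k, w k * ∫ y, sndPotential (S ^ 2) (optCov e (σ k ^ 2) (S ^ 2)) (m k) (∑ k, w k * m k) y ∂β
      = ∫ y, sndPotential (S ^ 2) (optCov e (S ^ 2) (S ^ 2)) (∑ k, w k * m k)
          (∑ k, w k * m k) y ∂β := by
  simp_rw [← integral_const_mul]
  rw [← integral_finsetSum _ fun k _ => (integrable_sndPotential _ _ hβ).const_mul _]
  simp_rw [sum_sndPotential hw1 hS]

/-- The barycenter objective exceeds its value at the Gaussian candidate by at least a relative
entropy of smoothed measures. -/
lemma objective_gaussianStd_add_klDiv_le (he : 0 < e) (hw : ∀ k, 0 < w k) (hw1 : ∑ k, w k = 1)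
    (hσ : ∀ k, 0 < σ k) (hS0 : 0 < S)
    (hS : ∑ k, w k * √(e ^ 2 + 4 * σ k ^ 2 * S ^ 2) = √(e ^ 2 + 4 * S ^ 4))
    {β : Measure ℝ} [IsProbabilityMeasure β] (hβ : MemLp id 2 β) {c : ℝ}
    (hc : c = optCov e (S ^ 2) (S ^ 2)) :
    ∑ k, w k * sinkhornDiv (2 * e) (gaussianStd (m k) (σ k)) (gaussianStd (∑ k, w k * m k) S)
        + e * (klDiv (β ∗ gaussianReal 0 (c + e - S ^ 2).toNNReal)
          (gaussianReal (∑ k, w k * m k) (c + e).toNNReal)).toReal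
      ≤ ∑ k, w k * sinkhornDiv (2 * e) (gaussianStd (m k) (σ k)) β := by
  have hS2 : 0 < S ^ 2 := by positivity
  have hσ2 : ∀ k, 0 < σ k ^ 2 := fun k => pow_pos (hσ k) 2
  have hck := fun k => optCov_pos (e := e) (hσ2 k) hS2
  have hck' := fun k => optCov_sq_add (e := e) (hσ2 k) hS2
  have hc0 := optCov_pos (e := e) hS2 hS2
  have hc' := optCov_sq_add (e := e) hS2 hS2
  have hγ := memLp_two_gaussianReal (∑ k, w k * m k) (S ^ 2).toNNReal
  have e1 := sum_integral_sndPotential (m := m) hβ hw1 hS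
  have e2 := sum_integral_sndPotential (m := m) hγ hw1 hS
  have lo := Finset.sum_le_sum fun k (_ : k ∈ Finset.univ) => mul_le_mul_of_nonneg_left
    (le_entropicOT_gaussianReal (m k) (∑ k, w k * m k) he (hσ2 k) hS2 (hck k) (hck' k) hβ)
    (hw k).le
  have up := Finset.sum_le_sum fun k (_ : k ∈ Finset.univ) => mul_le_mul_of_nonneg_left
    (entropicOT_gaussianReal_le (m k) (∑ k, w k * m k) he (hσ2 k) hS2 (hck k) (hck' k))
    (hw k).le
  have los := le_entropicOT_gaussianReal (∑ k, w k * m k) (∑ k, w k * m k) he hS2 hS2 hc0 hc' hγ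
  have ups := (entropicOT_self_le (m := ∑ k, w k * m k) he hS2 hc0 hc' hβ).2
  rw [integral_fstPotential_self hγ] at los
  rw [integral_fstPotential_self hβ] at ups
  rw [← hc] at e1 e2 los ups
  simp_rw [mul_add, Finset.sum_add_distrib] at lo up
  rw [e1] at lo
  rw [e2] at up
  rw [sum_sinkhornDiv hw1, sum_sinkhornDiv hw1]
  simp only [gaussianStd]
  -- This combines `lo` and `up` with half of `los` and `ups`; the integrals of the first potentials
  -- against the α_k cancel, and halving turns 2e into e.
  linarith

theorem debiasedBarycenters_gaussianStd (he : 0 < e) (hw : ∀ k, 0 < w k) (hw1 : ∑ k, w k = 1)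
    (hσ : ∀ k, 0 < σ k) (hS0 : 0 < S)
    (hS : ∑ k, w k * √(e ^ 2 + 4 * σ k ^ 2 * S ^ 2) = √(e ^ 2 + 4 * S ^ 4)) :
    debiasedBarycenters (2 * e) w (fun k => gaussianStd (m k) (σ k))
      = {gaussianStd (∑ k, w k * m k) S} := by
  have hS2 : 0 < S ^ 2 := by positivity
  have hc0 := optCov_pos (e := e) hS2 hS2
  have hc' := optCov_sq_add (e := e) hS2 hS2
  have hγ : gaussianStd (∑ k, w k * m k) S ∈ subGaussian := gaussianReal_mem_subGaussian _ _
  obtain ⟨c, hc⟩ : ∃ c, c = optCov e (S ^ 2) (S ^ 2) := ⟨_, rfl⟩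
  rw [← hc] at hc0 hc'
  have ht : 0 ≤ c + e - S ^ 2 := by nlinarith
  ext α
  simp only [debiasedBarycenters, Set.mem_ofPred_eq, Set.mem_singleton_iff]
  constructor
  · rintro ⟨hα, hmin⟩
    have := hα.1
    have hL := memLp_two_of_mem_subGaussian hα
    have h1 := objective_gaussianStd_add_klDiv_le (m := m) he hw hw1 hσ hS0 hS hL hc
    have h2 := hmin hγ
    simp only [Set.mem_ofPred_eq] at h2
    have hfin := (entropicOT_self_le (m := ∑ k, w k * m k) he hS2 hc0 hc' hL).1
    have h3 : (klDiv (α ∗ gaussianReal 0 (c + e - S ^ 2).toNNReal)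
        (gaussianReal (∑ k, w k * m k) (c + e).toNNReal)).toReal = 0 := by
      refine le_antisymm ?_ ENNReal.toReal_nonneg
      have : e * (klDiv (α ∗ gaussianReal 0 (c + e - S ^ 2).toNNReal)
        (gaussianReal (∑ k, w k * m k) (c + e).toNNReal)).toReal ≤ 0 := by linarith
      exact nonpos_of_mul_nonpos_right this he
    -- `hfin` excludes the value `⊤`, whose `toReal` is also 0.
    rw [ENNReal.toReal_eq_zero_iff, or_iff_left hfin, klDiv_eq_zero_iff] at h3
    refine eq_gaussianReal_of_conv_eq hS2.le ht ?_
    rw [h3, add_sub_cancel]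
  · rintro rfl
    refine ⟨hγ, fun β hβ => ?_⟩
    have := hβ.1
    have h1 := objective_gaussianStd_add_klDiv_le (m := m) he hw hw1 hσ hS0 hS
      (memLp_two_of_mem_subGaussian hβ) hc
    have h2 : 0 ≤ e * (klDiv (β ∗ gaussianReal 0 (c + e - S ^ 2).toNNReal)
        (gaussianReal (∑ k, w k * m k) (c + e).toNNReal)).toReal := by positivity
    simp only [Set.mem_ofPred_eq]
    linarith

end Barycenter

end SinkhornBarycenter

theorem mainTheorem1 {K : ℕ} (ε ε' : ℝ) (hε : 0 < ε) (hεε' : ε = 2 * ε' ^ 2)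
    (w μ σ : Fin K → ℝ) (hw : ∀ k, 0 < w k) (hw1 : ∑ k, w k = 1) (hσ : ∀ k, 0 < σ k) :
    (∃ S : ℝ,
      -- `S` is the unique positive solution of the fixed point equation
      (0 < S ∧ ∑ k, w k * √(ε' ^ 4 + 4 * σ k ^ 2 * S ^ 2) = √(ε' ^ 4 + 4 * S ^ 4)) ∧
      (∀ T : ℝ, 0 < T →
        ∑ k, w k * √(ε' ^ 4 + 4 * σ k ^ 2 * T ^ 2) = √(ε' ^ 4 + 4 * T ^ 4) → T = S) ∧
      -- the debiased barycenter exists, is unique and equals `N(∑ k, w k * μ k, S²)`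
      SinkhornBarycenter.debiasedBarycenters ε w
          (fun k => SinkhornBarycenter.gaussianStd (μ k) (σ k))
        = {SinkhornBarycenter.gaussianStd (∑ k, w k * μ k) S} ∧
      -- `S` lies between the smallest and the largest `σ k`, strictly if these differ
      (⨅ k, σ k) ≤ S ∧ S ≤ (⨆ k, σ k) ∧
      ((∃ i j, σ i ≠ σ j) → (⨅ k, σ k) < S ∧ S < (⨆ k, σ k))) ∧
    (∀ s : ℝ, (∀ k, σ k = s) →
      SinkhornBarycenter.debiasedBarycenters ε w
          (fun k => SinkhornBarycenter.gaussianStd (μ k) (σ k))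
        = {SinkhornBarycenter.gaussianStd (∑ k, w k * μ k) s}) := by
  obtain ⟨e, he⟩ : ∃ e, e = ε' ^ 2 := ⟨_, rfl⟩
  have he0 : 0 < e := by rw [he]; linarith
  have he4 : ε' ^ 4 = e ^ 2 := by rw [he]; ring
  rw [he4]
  rw [← he] at hεε'
  subst hεε'
  constructor
  · obtain ⟨S, hS0, hS, hS1, hS2⟩ :=
      SinkhornBarycenter.exists_fixedPoint (e := e) hw hw1 hσ
    exact ⟨S, ⟨hS0, hS⟩,
      fun T hT hT' => SinkhornBarycenter.fixedPoint_unique he0 hw hw1 hS0 hT hS hT',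
      SinkhornBarycenter.debiasedBarycenters_gaussianStd he0 hw hw1 hσ hS0 hS, hS1, hS2,
      fun hne => ⟨SinkhornBarycenter.ciInf_lt_fixedPoint hw hw1 hσ hS0 hS hS1 hne,
        SinkhornBarycenter.fixedPoint_lt_ciSup hw hw1 hσ hS0 hS hS2 hne⟩⟩
  · intro s hs
    have hne : (Finset.univ : Finset (Fin K)).Nonempty :=
      Finset.nonempty_of_sum_ne_zero (f := w) (by rw [hw1]; exact one_ne_zero)
    obtain ⟨k, -⟩ := hne
    have hs0 : 0 < s := hs k ▸ hσ k
    refine SinkhornBarycenter.debiasedBarycenters_gaussianStd he0 hw hw1 hσ hs0 ?_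
    simp_rw [hs, ← Finset.sum_mul, hw1, one_mul]
    congr 1
    ring
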